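/- Let $\tau_i$ be a DAG task: a finite directed acyclic graph whose vertices $v$ have worst-case execution times (WCETs) $c(v)\ge 0$. Let $C_i=\sum_v c(v)$ and let $L_i$ be the maximal total WCET of the vertices along a directed path. Let one instance of the task be released and executed through $m\ge 1$ container tasks $\varphi_1,\dots,\varphi_m$ with load bounds $\delta_1\ge\dots\ge\delta_m>0$, all empty at the release, by the following dispatcher. Let $S$ be the set of vertices not yet executed, initially all vertices. A vertex in $S$ is eligible when all its predecessors are finished. Whenever there are both an eligible vertex and an empty container task, the dispatcher is invoked (repeatedly at the same time $t$, if necessary). It removes an arbitrary eligible vertex $v$ from $S$ and takes an empty container task $\varphi_p$ with the largest load bound; let $d'$ be the earliest absolute deadline of the occupied container tasks with load bound strictly larger than $\delta_p$ ($d'=\infty$ if there is none). * If all container tasks are empty or $d'>t+c(v)/\delta_p$, then $\varphi_p$ is occupied by $v$ with absolute deadline $d_p=t+c(v)/\delta_p$. * Otherwise $d_p=d'$, and $v$ is split into $v'$ and $v''$ with $c(v')=(d_p-t)\,\delta_p$ and $c(v'')=c(v)-c(v')$; $\varphi_p$ is occupied by $v'$, while $v''$ is put back into $S$ and may be executed only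 after $v'$ is finished. The successors of $v$ have to wait for both parts. An occupied container task becomes empty when time reaches its absolute deadline. The actual time at which a container task finishes the workload assigned to it is any time not before the assignment. Suppose that each container task always finishes its assigned workload by the corresponding absolute deadline. Then the instance gets finished, and its response time $R$ (the time from the release until all vertices are finished) satisfies $$R\le\frac{C_i+\lambda L_i}{S_m},\qquad\text{where}\quad S_x=\sum_{j=1}^{x}\delta_j,\quad \lambda=\max_{1\le x\le m}\frac{S_m-S_x}{\delta_x}.$$ -/

import Mathlib

namespace SemiFederated

/-- One release of a DAG task: a directed acyclic graph on the vertex set `V` (`edge v u` says that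
`u` can only be executed after `v` is finished) with worst-case execution times. -/
structure DAGTask (V : Type*) where
  edge : V → V → Prop
  acyclic : ∀ v, ¬ Relation.TransGen edge v v
  wcet : V → ℝ
  wcet_nonneg : ∀ v, 0 ≤ wcet v

/-- The total worst-case execution time `C` of the task. -/
noncomputable def DAGTask.volume {V : Type*} [Fintype V] (G : DAGTask V) : ℝ :=
  ∑ v, G.wcet v

/-- The critical path length `L`: the maximal total WCET along a directed path of the DAG. -/
noncomputable def DAGTask.criticalPath {V : Type*} (G : DAGTask V) : ℝ :=
  sSup {x : ℝ | ∃ path : List V, path.IsChain G.edge ∧ x = (path.map G.wcet).sum}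

/-- The sum of the load bounds with indices up to `x` (for load bounds in non-increasing order,
the sum of the largest ones). -/
noncomputable def partialSpeed {m : ℕ} (δ : Fin m → ℝ) (x : Fin m) : ℝ :=
  ∑ i ∈ Finset.Iic x, δ i

/-- The sum of all load bounds. -/
noncomputable def totalSpeed {m : ℕ} (δ : Fin m → ℝ) : ℝ :=
  ∑ i, δ i

/-- The uniformity of the load bounds `δ` (listed in non-increasing order). -/
noncomputable def uniformity {m : ℕ} (δ : Fin m → ℝ) : ℝ :=
  ⨆ x : Fin m, (totalSpeed δ - partialSpeed δ x) / δ x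

/-- The record of one invocation of the dispatcher: at time `start` a part of `vertex`, of WCET
`wcet`, is put into `container`, with absolute deadline `deadline`. `isSplit` tells whether the
vertex has been split, so that a remaining part of it has been put back into the set of vertices
not yet executed. `finish` is the time at which the container has finished this workload. -/
structure Job (V : Type*) (m : ℕ) where
  vertex : V
  container : Fin m
  start : ℝ
  deadline : ℝ
  wcet : ℝ
  isSplit : Prop
  finish : ℝ

section Dispatcher

variable {V : Type*} {m : ℕ}

/-- The container task `p` is occupied at time `t`; it becomes empty when time reaches its absolute
deadline (even if the assigned workload has been finished earlier). -/
def Occupied (H : List (Job V m)) (p : Fin m) (t : ℝ) : Prop :=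
  ∃ j ∈ H, j.container = p ∧ j.start ≤ t ∧ t < j.deadline

/-- After the invocations `H`, the set `S` of the dispatcher still holds (the remaining part
of) `v`: every part of `v` dispatched so far was split off from it. -/
def InS (H : List (Job V m)) (v : V) : Prop :=
  ∀ j ∈ H, j.vertex = v → j.isSplit

/-- The WCET of the remaining part of `v` after the invocations `H`. -/
noncomputable def remaining (G : DAGTask V) : List (Job V m) → V → ℝ
  | [], v => G.wcet v
  | j :: H, v => by
      classical exact if j.vertex = v then remaining G H v - j.wcet else remaining G H v

/-- All parts into which `v` was divided have been dispatched and are finished at time `t`. -/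
def VertexFinished (H : List (Job V m)) (v : V) (t : ℝ) : Prop :=
  ¬ InS H v ∧ ∀ j ∈ H, j.vertex = v → j.finish ≤ t

/-- The (remaining part of the) vertex `v` is in `S` and eligible at time `t`: all predecessors
of `v` are finished, and so are the parts that were split off from `v` before. -/
def Eligible (G : DAGTask V) (H : List (Job V m)) (v : V) (t : ℝ) : Prop :=
  InS H v ∧ (∀ u, G.edge u v → VertexFinished H u t) ∧ ∀ j ∈ H, j.vertex = v → j.finish ≤ t

/-- The dispatcher has to be invoked at time `t`: there are both an eligible vertex and an empty
container task. -/
def MustInvoke (G : DAGTask V) (H : List (Job V m)) (t : ℝ) : Prop :=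
  (∃ v, Eligible G H v t) ∧ ∃ p, ¬ Occupied H p t

/-- The deadlines at time `t` of the occupied container tasks with load bound strictly larger than
that of `p`. -/
def fasterDeadlines (δ : Fin m → ℝ) (H : List (Job V m)) (p : Fin m) (t : ℝ) : Set ℝ :=
  {d | ∃ j ∈ H, δ p < δ j.container ∧ j.start ≤ t ∧ t < j.deadline ∧ d = j.deadline}

/-- The condition under which the dispatcher does not split: all container tasks are empty, or the
earliest deadline of the faster occupied container tasks (infinity if there is none) is later than
the deadline `t + c / δ p` of the entire remaining part, of WCET `c`. -/
def NoSplit (δ : Fin m → ℝ) (H : List (Job V m)) (p : Fin m) (t c : ℝ) : Prop :=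
  (∀ q, ¬ Occupied H q t) ∨ ∀ d ∈ fasterDeadlines δ H p t, t + c / δ p < d

/-- One invocation of the dispatching algorithm after the invocations `H`, recorded by `j`: an
arbitrary eligible vertex is put into an empty container task with the largest load bound, entirely
if it need not be split, and otherwise only a part of it that reaches exactly to the earliest
deadline of the faster occupied container tasks. The finishing time is decided by the execution of
the container tasks; it is only known not to precede the start. -/
structure Dispatch (G : DAGTask V) (δ : Fin m → ℝ) (H : List (Job V m)) (j : Job V m) : Prop where
  eligible : Eligible G H j.vertex j.start
  container_empty : ¬ Occupied H j.container j.start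
  container_fastest : ∀ q, ¬ Occupied H q j.start → δ q ≤ δ j.container
  isSplit_iff : j.isSplit ↔ ¬ NoSplit δ H j.container j.start (remaining G H j.vertex)
  whole : ¬ j.isSplit →
    j.deadline = j.start + remaining G H j.vertex / δ j.container ∧
    j.wcet = remaining G H j.vertex
  split : j.isSplit →
    IsLeast (fasterDeadlines δ H j.container j.start) j.deadline ∧
    j.wcet = (j.deadline - j.start) * δ j.container
  start_le_finish : j.start ≤ j.finish

/-- The time of the latest invocation in `H` (latest first), or the release time `r`. -/
def now (r : ℝ) : List (Job V m) → ℝ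
  | [] => r
  | j :: _ => j.start

/-- The next invocation after `H` is `j`: the dispatcher is invoked as soon as there are both an
eligible vertex and an empty container task (repeatedly at the same time, if need be). -/
def NextInvocation (G : DAGTask V) (δ : Fin m → ℝ) (r : ℝ) (H : List (Job V m)) (j : Job V m) :
    Prop :=
  now r H ≤ j.start ∧ (∀ s, now r H ≤ s → s < j.start → ¬ MustInvoke G H s) ∧ Dispatch G δ H j

/-- A schedule produced by the dispatcher for an instance released at time `r`, with all container
tasks empty at the release. `history n` holds the first `n` invocations (latest first), or all of
them if there are fewer than `n`: the history stops growing only if the dispatcher is never invoked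
again. -/
structure Schedule (G : DAGTask V) (δ : Fin m → ℝ) (r : ℝ) where
  history : ℕ → List (Job V m)
  history_zero : history 0 = []
  history_succ : ∀ n,
    (∃ j, NextInvocation G δ r (history n) j ∧ history (n + 1) = j :: history n) ∨
    ((∀ t, now r (history n) ≤ t → ¬ MustInvoke G (history n) t) ∧ history (n + 1) = history n)

variable {G : DAGTask V} {δ : Fin m → ℝ} {r : ℝ}

/-- Each container task finishes each assigned workload by the corresponding absolute deadline. -/
def Schedule.MeetsDeadlines (σ : Schedule G δ r) : Prop :=
  ∀ n, ∀ j ∈ σ.history n, j.finish ≤ j.deadline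

/-- The task instance is finished at time `t`. -/
def Schedule.FinishedAt (σ : Schedule G δ r) (t : ℝ) : Prop :=
  ∃ n, ∀ v, VertexFinished (σ.history n) v t

/-- `R` is the response time: the least time after the release at which the instance is finished.
In particular the instance does get finished. -/
def Schedule.IsResponseTime (σ : Schedule G δ r) (R : ℝ) : Prop :=
  IsLeast {x : ℝ | 0 ≤ x ∧ σ.FinishedAt (r + x)} R

end Dispatcher

end SemiFederated

/-!
The volume of the instance bounds the capacity reserved by occupied containers, and the critical
path bounds the capacity left idle; adding both over `[r, r + R]` gives `totalSpeed δ * R`.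

* *Termination.* A split creates no new deadline, since it copies the deadline of an occupied
  container, and two split parts in the same container have different deadlines. Hence there are at
  most `|V|` deadlines and at most `|V| + m * |V|` invocations (`IsTrace.length_le`). When the
  invocations stop, a vertex left in `S` and minimal for the precedence order would become
  eligible, so nothing is left (`not_inS_of_terminal`).
* *The fastest containers are occupied.* A part never outlives the parts in faster containers: that
  is what splitting is for. So whenever a container is occupied, all strictly faster ones are
  (`IsTrace.occupied_of_faster`), and the idle capacity is at most the uniformity times the load
  bound of any occupied container (`IsTrace.idle_le_of_occupied`).
* *Critical path.* Once the predecessors of `v` are finished and until `v` is finished, either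
  all containers are occupied or a part of `v` is being executed (`IsTrace.executing_or_busy`).
  So the idle capacity during this time is at most `uniformity δ * wcet v`
  (`IsTrace.integral_idle_le_wcet`). Going back from `v` to its predecessor finished last, and so
  on, sums this bound along a directed path (`IsTrace.integral_idle_add_le`).

A container counts as occupied until the absolute deadline, even if its workload is finished
earlier, so each part of a vertex reserves exactly `wcet = (deadline - start) * δ container`.
-/

namespace SemiFederated

open MeasureTheory

/-! ### The task graph -/

section Graph

variable {V : Type*} [Fintype V]

theorem DAGTask.sum_le_volume (G : DAGTask V) {l : List V} (hl : l.IsChain G.edge) :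
    (l.map G.wcet).sum ≤ G.volume := by
  classical
  have hnd : l.Nodup := by
    have h1 : l.IsChain (Relation.TransGen G.edge) :=
      hl.imp fun _ _ h => Relation.TransGen.single h
    refine (List.isChain_iff_pairwise.1 h1).imp ?_
    rintro a b hab rfl
    exact G.acyclic a hab
  rw [← List.sum_toFinset _ hnd]
  exact Finset.sum_le_sum_of_subset_of_nonneg (Finset.subset_univ _)
    fun v _ _ => G.wcet_nonneg v

theorem DAGTask.sum_le_criticalPath (G : DAGTask V) {l : List V} (hl : l.IsChain G.edge) :
    (l.map G.wcet).sum ≤ G.criticalPath := by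
  refine le_csSup ⟨G.volume, ?_⟩ ⟨l, hl, rfl⟩
  rintro x ⟨l', hl', rfl⟩
  exact G.sum_le_volume hl'

theorem DAGTask.criticalPath_nonneg (G : DAGTask V) : 0 ≤ G.criticalPath := by
  simpa using G.sum_le_criticalPath (l := []) List.isChain_nil

theorem DAGTask.volume_nonneg (G : DAGTask V) : 0 ≤ G.volume :=
  Finset.sum_nonneg fun v _ => G.wcet_nonneg v

theorem DAGTask.wellFounded_edge (G : DAGTask V) : WellFounded G.edge := by
  have : Std.Irrefl (Relation.TransGen G.edge) := ⟨G.acyclic⟩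
  exact Subrelation.wf (fun h => Relation.TransGen.single h)
    (Finite.wellFounded_of_trans_of_irrefl (Relation.TransGen G.edge))

end Graph

/-! ### Load bounds -/

section Speed

variable {m : ℕ} {δ : Fin m → ℝ}

theorem le_uniformity (δ : Fin m → ℝ) (x : Fin m) :
    (totalSpeed δ - partialSpeed δ x) / δ x ≤ uniformity δ :=
  le_ciSup (f := fun x => (totalSpeed δ - partialSpeed δ x) / δ x) (Set.finite_range _).bddAbove x

theorem partialSpeed_le_totalSpeed (hpos : ∀ p, 0 < δ p) (x : Fin m) :
    partialSpeed δ x ≤ totalSpeed δ :=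
  Finset.sum_le_sum_of_subset_of_nonneg (Finset.subset_univ _) fun p _ _ => (hpos p).le

theorem uniformity_nonneg (hm : 0 < m) (hpos : ∀ p, 0 < δ p) : 0 ≤ uniformity δ :=
  (div_nonneg (sub_nonneg.2 (partialSpeed_le_totalSpeed hpos ⟨0, hm⟩)) (hpos _).le).trans
    (le_uniformity δ ⟨0, hm⟩)

theorem totalSpeed_pos (hm : 0 < m) (hpos : ∀ p, 0 < δ p) : 0 < totalSpeed δ :=
  Finset.sum_pos (fun p _ => hpos p) ⟨⟨0, hm⟩, Finset.mem_univ _⟩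

/-- A set of containers that holds `p` and all strictly faster containers leaves a speed of at most
`uniformity δ * δ p` to the other containers. -/
theorem totalSpeed_sub_sum_le (hpos : ∀ p, 0 < δ p) (hsorted : Antitone δ) {O : Finset (Fin m)}
    {p : Fin m} (hp : p ∈ O) (hO : ∀ q, δ p < δ q → q ∈ O) :
    totalSpeed δ - ∑ q ∈ O, δ q ≤ uniformity δ * δ p := by
  classical
  -- Ties: `x` is the first container that is as fast as `p`, so those before it are faster.
  obtain ⟨x, hx, hmin⟩ := WellFounded.has_min (wellFounded_lt (α := Fin m)) {q | δ q = δ p} ⟨p, rfl⟩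
  replace hx : δ x = δ p := hx
  have hlt : ∀ q, q < x → δ p < δ q := fun q hq =>
    lt_of_le_of_ne (hx ▸ hsorted hq.le) fun h => hmin q h.symm hq
  have hpx : p ∉ Finset.Iio x := fun h => lt_irrefl _ (hlt p (Finset.mem_Iio.1 h))
  have h1 : partialSpeed δ x = ∑ q ∈ insert p (Finset.Iio x), δ q := by
    rw [Finset.sum_insert hpx, partialSpeed, ← Finset.Iio_insert,
      Finset.sum_insert (by simp), hx]
  have h2 : partialSpeed δ x ≤ ∑ q ∈ O, δ q := by
    rw [h1]
    refine Finset.sum_le_sum_of_subset_of_nonneg ?_ fun q _ _ => (hpos q).le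
    intro q hq
    rcases Finset.mem_insert.1 hq with rfl | hq
    · exact hp
    · exact hO q (hlt q (Finset.mem_Iio.1 hq))
  have h3 := (div_le_iff₀ (hpos x)).1 (le_uniformity δ x)
  rw [hx] at h3
  linarith

end Speed

/-! ### Traces of the dispatcher -/

section Trace

variable {V : Type*} {m : ℕ}

/-- `H` (latest first) is a list of successive invocations of the dispatcher for an instance
released at time `r`; it need not contain all invocations. -/
inductive IsTrace (G : DAGTask V) (δ : Fin m → ℝ) (r : ℝ) : List (Job V m) → Prop
  | nil : IsTrace G δ r []
  | cons {j : Job V m} {H : List (Job V m)} (hH : IsTrace G δ r H)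
      (hj : NextInvocation G δ r H j) : IsTrace G δ r (j :: H)

variable {G : DAGTask V} {δ : Fin m → ℝ} {r : ℝ} {H K : List (Job V m)} {j : Job V m} {v : V}
  {t : ℝ}

theorem Schedule.isTrace (σ : Schedule G δ r) (n : ℕ) : IsTrace G δ r (σ.history n) := by
  induction n with
  | zero => rw [σ.history_zero]; exact .nil
  | succ n ih =>
    rcases σ.history_succ n with ⟨j, hj, h⟩ | ⟨-, h⟩
    · rw [h]; exact .cons ih hj
    · rw [h]; exact ih

theorem InS.of_subset (hKH : K ⊆ H) (h : InS H v) : InS K v :=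
  fun j hj => h j (hKH hj)

theorem Occupied.of_subset {p : Fin m} (hKH : K ⊆ H) (h : Occupied K p t) : Occupied H p t := by
  obtain ⟨j, hj, h⟩ := h
  exact ⟨j, hKH hj, h⟩

theorem exists_whole_of_not_inS (h : ¬ InS H v) : ∃ j ∈ H, j.vertex = v ∧ ¬ j.isSplit := by
  simpa [InS] using h

namespace IsTrace

theorem start_le_now (hH : IsTrace G δ r H) (hj : j ∈ H) : j.start ≤ now r H := by
  induction hH with
  | nil => simp at hj
  | cons _ hk ih =>
    rcases List.mem_cons.1 hj with rfl | hj
    · exact le_rfl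
    · exact (ih hj).trans hk.1

theorem release_le_now (hH : IsTrace G δ r H) : r ≤ now r H := by
  induction hH with
  | nil => exact le_rfl
  | cons _ hk ih => exact ih.trans hk.1

theorem release_le_start (hH : IsTrace G δ r H) (hj : j ∈ H) : r ≤ j.start := by
  induction hH with
  | nil => simp at hj
  | cons hH hk ih =>
    rcases List.mem_cons.1 hj with rfl | hj
    · exact hH.release_le_now.trans hk.1
    · exact ih hj

theorem start_le_finish (hH : IsTrace G δ r H) (hj : j ∈ H) : j.start ≤ j.finish := by
  induction hH with
  | nil => simp at hj
  | cons _ hk ih =>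
    rcases List.mem_cons.1 hj with rfl | hj
    · exact hk.2.2.start_le_finish
    · exact ih hj

/-- Once a vertex has left `S`, no further part of it is dispatched. -/
theorem mem_of_not_inS (hH : IsTrace G δ r H) (hK : K <:+ H) (hv : ¬ InS K v) (hj : j ∈ H)
    (hjv : j.vertex = v) : j ∈ K := by
  induction hH with
  | nil => simp at hj
  | cons _ hk ih =>
    rcases List.suffix_cons_iff.1 hK with rfl | hK'
    · exact hj
    rcases List.mem_cons.1 hj with rfl | hj
    · subst hjv
      exact absurd (hk.2.2.eligible.1.of_subset hK'.subset) hv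
    · exact ih hK' hj

/-- A part in a slower container does not outlive the parts in faster containers. -/
theorem occupied_of_faster (hH : IsTrace G δ r H) (hj : j ∈ H) (hs : j.start ≤ t)
    (hd : t < j.deadline) {q : Fin m} (hq : δ j.container < δ q) : Occupied H q t := by
  induction hH with
  | nil => simp at hj
  | @cons k H hH hk ih =>
    rcases List.mem_cons.1 hj with rfl | hj
    · have hocc : Occupied H q j.start := by
        by_contra h
        exact absurd (hk.2.2.container_fastest q h) (not_le.2 hq)
      have hocc' := hocc
      obtain ⟨i, hi, rfl, his, hid⟩ := hocc
      have hmem : i.deadline ∈ fasterDeadlines δ H j.container j.start :=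
        ⟨i, hi, hq, his, hid, rfl⟩
      have hle : j.deadline ≤ i.deadline := by
        by_cases hsp : j.isSplit
        · exact (hk.2.2.split hsp).1.2 hmem
        · have hns : NoSplit δ H j.container j.start (remaining G H j.vertex) := by
            by_contra h
            exact hsp (hk.2.2.isSplit_iff.2 h)
          rw [(hk.2.2.whole hsp).1]
          rcases hns with h | h
          · exact absurd hocc' (h _)
          · exact (h _ hmem).le
      exact ⟨i, List.mem_cons_of_mem _ hi, rfl, his.trans hs, hd.trans_le hle⟩
    · exact (ih hj).of_subset (List.subset_cons_self _ _)

/-- At time `t` the invocations up to time `t` leave no reason for another invocation. -/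
theorem exists_stage (hH : IsTrace G δ r H) (hr : r ≤ t)
    (hterm : now r H ≤ t → ¬ MustInvoke G H t) :
    ∃ K, K <:+ H ∧ (∀ j ∈ H, j.start ≤ t → j ∈ K) ∧ (∀ j ∈ K, j.start ≤ t) ∧
      ¬ MustInvoke G K t := by
  induction hH with
  | nil => exact ⟨[], List.suffix_rfl, by simp, by simp, hterm hr⟩
  | @cons k H hH hk ih =>
    by_cases hkt : k.start ≤ t
    · exact ⟨k :: H, List.suffix_rfl, fun j hj _ => hj,
        fun j hj => ((hH.cons hk).start_le_now hj).trans hkt, hterm hkt⟩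
    · obtain ⟨K, hKH, h1, h2, h3⟩ := ih fun h => hk.2.1 t h (not_le.1 hkt)
      refine ⟨K, hKH.trans (List.suffix_cons _ _), fun j hj hjt => ?_, h2, h3⟩
      rcases List.mem_cons.1 hj with rfl | hj
      · exact absurd hjt hkt
      · exact h1 j hj hjt

/-- While `v` is unfinished and its predecessors are finished, either a part of `v` is being
executed or all containers are occupied. -/
theorem executing_or_busy (hH : IsTrace G δ r H) (hr : r ≤ t)
    (hterm : ∀ s, now r H ≤ s → ¬ MustInvoke G H s)
    (hpred : ∀ u, G.edge u v → VertexFinished H u t)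
    (hv : ∃ j ∈ H, j.vertex = v ∧ t < j.finish) :
    (∃ j ∈ H, j.vertex = v ∧ j.start ≤ t ∧ t < j.finish) ∨ ∀ q, Occupied H q t := by
  obtain ⟨K, hKH, hmem, hstart, hno⟩ := hH.exists_stage hr (hterm t)
  by_cases hS : InS K v
  · rw [or_iff_not_imp_left]
    intro hex q
    by_contra hq
    refine hno ⟨⟨v, hS, fun u hu => ⟨?_, fun j hj => (hpred u hu).2 j (hKH.subset hj)⟩, ?_⟩,
      q, fun h => hq (h.of_subset hKH.subset)⟩
    · obtain ⟨j, hj, hju, hjs⟩ := exists_whole_of_not_inS (hpred u hu).1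
      exact fun h => hjs (h j (hmem j hj ((hH.start_le_finish hj).trans
        ((hpred u hu).2 j hj hju))) hju)
    · intro j hj hjv
      by_contra h
      exact hex ⟨j, hKH.subset hj, hjv, hstart j hj, not_le.1 h⟩
  · obtain ⟨j, hj, hjv, hjt⟩ := hv
    exact .inl ⟨j, hj, hjv, hstart j (hH.mem_of_not_inS hKH hS hj hjv), hjt⟩

/-! ### Reserved workload -/

theorem remaining_nonneg (hpos : ∀ p, 0 < δ p) (hH : IsTrace G δ r H) (v : V) :
    0 ≤ remaining G H v := by
  induction hH with
  | nil => exact G.wcet_nonneg v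
  | @cons j H hH hj ih =>
    rw [remaining]
    split_ifs with hjv
    · subst hjv
      by_cases hsp : j.isSplit
      · obtain ⟨hleast, hw⟩ := hj.2.2.split hsp
        have hns := hj.2.2.isSplit_iff.1 hsp
        simp only [NoSplit, not_or, not_forall, not_lt] at hns
        obtain ⟨-, d, hd, hle⟩ := hns
        have h1 : j.deadline - j.start ≤ remaining G H j.vertex / δ j.container := by
          linarith [hleast.2 hd]
        rw [hw]
        linarith [(le_div_iff₀ (hpos _)).1 h1]
      · rw [(hj.2.2.whole hsp).2, sub_self]
    · exact ih

theorem start_le_deadline (hpos : ∀ p, 0 < δ p) (hH : IsTrace G δ r H) (hj : j ∈ H) :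
    j.start ≤ j.deadline := by
  induction hH with
  | nil => simp at hj
  | @cons k H hH hk ih =>
    rcases List.mem_cons.1 hj with rfl | hj
    · by_cases hsp : j.isSplit
      · obtain ⟨i, -, -, -, h, heq⟩ := (hk.2.2.split hsp).1.1
        rw [heq]
        exact h.le
      · rw [(hk.2.2.whole hsp).1]
        linarith [div_nonneg (hH.remaining_nonneg hpos j.vertex) (hpos j.container).le]
    · exact ih hj

theorem wcet_eq (hpos : ∀ p, 0 < δ p) (hH : IsTrace G δ r H) (hj : j ∈ H) :
    j.wcet = δ j.container * (j.deadline - j.start) := by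
  induction hH with
  | nil => simp at hj
  | @cons k H hH hk ih =>
    rcases List.mem_cons.1 hj with rfl | hj
    · by_cases hsp : j.isSplit
      · rw [(hk.2.2.split hsp).2, mul_comm]
      · have := (hpos j.container).ne'
        rw [(hk.2.2.whole hsp).1, (hk.2.2.whole hsp).2]
        field_simp
        ring
    · exact ih hj

end IsTrace

theorem sum_wcet_add_remaining [DecidableEq V] (G : DAGTask V) (H : List (Job V m)) (v : V) :
    ((H.filter (·.vertex = v)).map Job.wcet).sum + remaining G H v = G.wcet v := by
  induction H with
  | nil => simp [remaining]
  | cons j H ih =>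
    by_cases h : j.vertex = v
    · simp only [remaining, h, decide_true, List.filter_cons_of_pos, List.map_cons,
        List.sum_cons, if_true]
      linarith
    · simpa [remaining, h] using ih

theorem sum_wcet_add_sum_remaining [Fintype V] (G : DAGTask V) (H : List (Job V m)) :
    (H.map Job.wcet).sum + ∑ v, remaining G H v = G.volume := by
  classical
  induction H with
  | nil => simp [remaining, DAGTask.volume]
  | cons j H ih =>
    have h : ∀ v, remaining G (j :: H) v =
        remaining G H v - if j.vertex = v then j.wcet else 0 := fun v => by
      by_cases h : j.vertex = v <;> simp [remaining, h]
    simp only [h, Finset.sum_sub_distrib, Finset.sum_ite_eq, Finset.mem_univ, if_true,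
      List.map_cons, List.sum_cons]
    linarith

/-- The total speed at time `t` of the containers in the parts `H`: each part counts with the load
bound of its container from its start to its deadline. -/
noncomputable def reservedSpeed (δ : Fin m → ℝ) (H : List (Job V m)) (t : ℝ) : ℝ :=
  (H.map fun j => (Set.Ico j.start j.deadline).indicator (fun _ => δ j.container) t).sum

theorem reservedSpeed_cons (δ : Fin m → ℝ) (j : Job V m) (H : List (Job V m)) (t : ℝ) :
    reservedSpeed δ (j :: H) t =
      (Set.Ico j.start j.deadline).indicator (fun _ => δ j.container) t + reservedSpeed δ H t := by
  simp [reservedSpeed]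

theorem intervalIntegrable_indicator_Ico (s d c a b : ℝ) :
    IntervalIntegrable ((Set.Ico s d).indicator fun _ => c) volume a b :=
  ((integrable_indicator_iff measurableSet_Ico).2
    (integrableOn_const (by simp))).intervalIntegrable

theorem integral_indicator_Ico_le {s d c a b : ℝ} (hsd : s ≤ d) (hc : 0 ≤ c) (hab : a ≤ b) :
    ∫ t in a..b, (Set.Ico s d).indicator (fun _ => c) t ≤ c * (d - s) := by
  have hint : Integrable ((Set.Ico s d).indicator fun _ => c) volume :=
    (integrable_indicator_iff measurableSet_Ico).2 (integrableOn_const (by simp))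
  calc ∫ t in a..b, (Set.Ico s d).indicator (fun _ => c) t
      = ∫ t in Set.Ioc a b, (Set.Ico s d).indicator (fun _ => c) t :=
        intervalIntegral.integral_of_le hab
    _ ≤ ∫ t, (Set.Ico s d).indicator (fun _ => c) t :=
        setIntegral_le_integral hint
          (Filter.Eventually.of_forall fun t => Set.indicator_nonneg (fun _ _ => hc) t)
    _ = c * (d - s) := by
        rw [integral_indicator measurableSet_Ico, setIntegral_const]
        simp [Measure.real, hsd, mul_comm]

theorem intervalIntegrable_reservedSpeed (δ : Fin m → ℝ) (H : List (Job V m)) (a b : ℝ) :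
    IntervalIntegrable (reservedSpeed δ H) volume a b := by
  induction H with
  | nil =>
    have : reservedSpeed δ ([] : List (Job V m)) = fun _ => 0 := rfl
    rw [this]
    exact intervalIntegrable_const
  | cons j H ih =>
    have : reservedSpeed δ (j :: H) = fun t =>
        (Set.Ico j.start j.deadline).indicator (fun _ => δ j.container) t +
          reservedSpeed δ H t := funext (reservedSpeed_cons δ j H)
    rw [this]
    exact (intervalIntegrable_indicator_Ico _ _ _ _ _).add ih

theorem integral_reservedSpeed_le (hpos : ∀ p, 0 < δ p) (hd : ∀ j ∈ H, j.start ≤ j.deadline)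
    (hw : ∀ j ∈ H, j.wcet = δ j.container * (j.deadline - j.start)) {a b : ℝ} (hab : a ≤ b) :
    ∫ t in a..b, reservedSpeed δ H t ≤ (H.map Job.wcet).sum := by
  induction H with
  | nil => simp [reservedSpeed]
  | cons j H ih =>
    simp only [reservedSpeed_cons]
    rw [intervalIntegral.integral_add (intervalIntegrable_indicator_Ico _ _ _ _ _)
      (intervalIntegrable_reservedSpeed _ _ _ _), List.map_cons, List.sum_cons,
      hw j List.mem_cons_self]
    exact add_le_add
      (integral_indicator_Ico_le (hd j List.mem_cons_self) (hpos _).le hab)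
      (ih (fun i hi => hd i (List.mem_cons_of_mem _ hi))
        fun i hi => hw i (List.mem_cons_of_mem _ hi))

theorem reservedSpeed_nonneg (hpos : ∀ p, 0 < δ p) (H : List (Job V m)) (t : ℝ) :
    0 ≤ reservedSpeed δ H t := by
  refine List.sum_nonneg fun x hx => ?_
  obtain ⟨j, -, rfl⟩ := List.mem_map.1 hx
  exact Set.indicator_nonneg (fun _ _ => (hpos _).le) t

theorem le_reservedSpeed_of_mem (hpos : ∀ p, 0 < δ p) (hj : j ∈ H) (hs : j.start ≤ t)
    (hd : t < j.deadline) : δ j.container ≤ reservedSpeed δ H t := by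
  have h : (Set.Ico j.start j.deadline).indicator (fun _ => δ j.container) t = δ j.container :=
    Set.indicator_of_mem (Set.mem_Ico.2 ⟨hs, hd⟩) _
  rw [← h]
  refine List.single_le_sum ?_ _ (List.mem_map.2 ⟨j, hj, rfl⟩)
  intro x hx
  obtain ⟨i, -, rfl⟩ := List.mem_map.1 hx
  exact Set.indicator_nonneg (fun _ _ => (hpos _).le) t

theorem sum_occupied_le_reservedSpeed (hpos : ∀ p, 0 < δ p) (H : List (Job V m)) (t : ℝ)
    (O : Finset (Fin m)) (hO : ∀ q ∈ O, Occupied H q t) :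
    ∑ q ∈ O, δ q ≤ reservedSpeed δ H t := by
  classical
  induction H generalizing O with
  | nil =>
    have : O = ∅ := Finset.eq_empty_of_forall_notMem fun q hq => by
      simpa [Occupied] using hO q hq
    simp [this, reservedSpeed]
  | cons j H ih =>
    rw [reservedSpeed_cons]
    by_cases ht : t ∈ Set.Ico j.start j.deadline
    · rw [Set.indicator_of_mem ht]
      have h1 := ih (O.erase j.container) fun q hq => by
        obtain ⟨i, hi, hiq, h⟩ := hO q (Finset.mem_of_mem_erase hq)
        rcases List.mem_cons.1 hi with rfl | hi
        · exact absurd hiq.symm (Finset.ne_of_mem_erase hq)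
        · exact ⟨i, hi, hiq, h⟩
      have h2 : ∑ q ∈ O, δ q ≤ ∑ q ∈ insert j.container (O.erase j.container), δ q :=
        Finset.sum_le_sum_of_subset_of_nonneg (Finset.insert_erase_subset _ _)
          fun q _ _ => (hpos q).le
      rw [Finset.sum_insert (Finset.notMem_erase _ _)] at h2
      linarith
    · rw [Set.indicator_of_notMem ht, zero_add]
      refine ih O fun q hq => ?_
      obtain ⟨i, hi, hiq, h⟩ := hO q hq
      rcases List.mem_cons.1 hi with rfl | hi
      · exact absurd h ht
      · exact ⟨i, hi, hiq, h⟩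

namespace IsTrace

theorem idle_le_of_occupied (hpos : ∀ p, 0 < δ p) (hsorted : Antitone δ) (hH : IsTrace G δ r H)
    (hj : j ∈ H) (hs : j.start ≤ t) (hd : t < j.deadline) :
    totalSpeed δ - reservedSpeed δ H t ≤ uniformity δ * δ j.container := by
  classical
  have h1 := sum_occupied_le_reservedSpeed hpos H t {q | Occupied H q t} (by simp)
  have h2 := totalSpeed_sub_sum_le hpos hsorted (O := {q | Occupied H q t}) (p := j.container)
    (by simpa using ⟨j, hj, rfl, hs, hd⟩)
    (fun q hq => by simpa using hH.occupied_of_faster hj hs hd hq)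
  linarith

/-! ### Termination -/

/-- The witnesses in the induction are the vertices `A` that have left `S`, the deadlines `D`, and
the pairs `B` of container and deadline of the split parts. -/
theorem length_le [Fintype V] (hH : IsTrace G δ r H) :
    H.length ≤ Fintype.card V + m * Fintype.card V := by
  classical
  have key : ∃ (A : Finset V) (D : Finset ℝ) (B : Finset (Fin m × ℝ)),
      (∀ v ∈ A, ¬ InS H v) ∧ (∀ j ∈ H, j.deadline ∈ D) ∧ D.card ≤ A.card ∧
      (∀ x ∈ B, ∃ j ∈ H, j.container = x.1 ∧ j.deadline = x.2) ∧
      H.length ≤ A.card + B.card := by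
    induction hH with
    | nil => exact ⟨∅, ∅, ∅, by simp, by simp, by simp, by simp, by simp⟩
    | @cons j H hH hj ih =>
      obtain ⟨A, D, B, hA, hD, hDA, hB, hlen⟩ := ih
      have hA' : ∀ v ∈ A, ¬ InS (j :: H) v := fun v hv h =>
        hA v hv (h.of_subset (List.subset_cons_self _ _))
      have hB' : ∀ x ∈ B, ∃ i ∈ j :: H, i.container = x.1 ∧ i.deadline = x.2 := fun x hx => by
        obtain ⟨i, hi, h⟩ := hB x hx
        exact ⟨i, List.mem_cons_of_mem _ hi, h⟩
      by_cases hsp : j.isSplit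
      · obtain ⟨i, hi, -, -, hid, hdi⟩ := (hj.2.2.split hsp).1.1
        have hnew : (j.container, j.deadline) ∉ B := fun h => by
          obtain ⟨k, hk, hkc, hkd⟩ := hB _ h
          refine hj.2.2.container_empty ⟨k, hk, hkc, (hH.start_le_now hk).trans hj.1, ?_⟩
          simp only at hkd
          rwa [hkd, hdi]
        refine ⟨A, D, insert (j.container, j.deadline) B, hA', ?_, hDA, ?_, ?_⟩
        · intro k hk
          rcases List.mem_cons.1 hk with rfl | hk
          · rw [hdi]; exact hD i hi
          · exact hD k hk
        · intro x hx
          rcases Finset.mem_insert.1 hx with rfl | hx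
          · exact ⟨j, List.mem_cons_self, rfl, rfl⟩
          · exact hB' x hx
        · rw [Finset.card_insert_of_notMem hnew, List.length_cons]
          omega
      · have hnew : j.vertex ∉ A := fun h => hA _ h hj.2.2.eligible.1
        refine ⟨insert j.vertex A, insert j.deadline D, B, ?_, ?_, ?_, hB', ?_⟩
        · intro v hv
          rcases Finset.mem_insert.1 hv with rfl | hv
          · exact fun h => hsp (h j List.mem_cons_self rfl)
          · exact hA' v hv
        · intro k hk
          rcases List.mem_cons.1 hk with rfl | hk
          · exact Finset.mem_insert_self _ _
          · exact Finset.mem_insert_of_mem (hD k hk)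
        · rw [Finset.card_insert_of_notMem hnew]
          exact (Finset.card_insert_le _ _).trans (by omega)
        · rw [Finset.card_insert_of_notMem hnew, List.length_cons]
          omega
  obtain ⟨A, D, B, -, hD, hDA, hB, hlen⟩ := key
  have hAV : A.card ≤ Fintype.card V := Finset.card_le_univ A
  have hBD : B.card ≤ m * D.card := by
    have : B ⊆ Finset.univ ×ˢ D := fun x hx => by
      obtain ⟨j, hj, -, h⟩ := hB x hx
      simpa [← h] using hD j hj
    simpa using Finset.card_le_card this
  have hmul : m * D.card ≤ m * Fintype.card V := Nat.mul_le_mul_left _ (hDA.trans hAV)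
  omega

end IsTrace

theorem not_inS_of_terminal [Fintype V] (hm : 0 < m)
    (hterm : ∀ s, now r H ≤ s → ¬ MustInvoke G H s) (v : V) : ¬ InS H v := by
  obtain ⟨T, hT⟩ : ∃ T, ∀ j ∈ H, j.deadline ≤ T ∧ j.finish ≤ T := by
    clear hterm
    induction H with
    | nil => exact ⟨0, by simp⟩
    | cons j H ih =>
      obtain ⟨T, hT⟩ := ih
      refine ⟨max T (max j.deadline j.finish), fun i hi => ?_⟩
      rcases List.mem_cons.1 hi with rfl | hi
      · simp
      · exact ⟨(hT i hi).1.trans (le_max_left _ _), (hT i hi).2.trans (le_max_left _ _)⟩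
  have hT' : ∀ j ∈ H, j.deadline ≤ max T (now r H) ∧ j.finish ≤ max T (now r H) := fun j hj =>
    ⟨(hT j hj).1.trans (le_max_left _ _), (hT j hj).2.trans (le_max_left _ _)⟩
  induction v using G.wellFounded_edge.induction with
  | _ v ih =>
    intro hv
    refine hterm (max T (now r H)) (le_max_right _ _)
      ⟨⟨v, hv, fun u hu => ⟨ih u hu, fun j hj _ => (hT' j hj).2⟩, fun j hj _ => (hT' j hj).2⟩,
        ⟨0, hm⟩, ?_⟩
    rintro ⟨j, hj, -, -, h⟩
    exact absurd (hT' j hj).1 (not_le.2 h)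

theorem Schedule.exists_terminal [Fintype V] (σ : Schedule G δ r) :
    ∃ n, ∀ t, now r (σ.history n) ≤ t → ¬ MustInvoke G (σ.history n) t := by
  by_contra hcon
  have hlen : ∀ n, (σ.history n).length = n := fun n => by
    induction n with
    | zero => simp [σ.history_zero]
    | succ n ih =>
      rcases σ.history_succ n with ⟨j, -, h⟩ | ⟨h, -⟩
      · rw [h, List.length_cons, ih]
      · exact absurd ⟨n, h⟩ hcon
  have h := (σ.isTrace (Fintype.card V + m * Fintype.card V + 1)).length_le
  rw [hlen] at h
  omega

theorem Schedule.history_eq_of_const (σ : Schedule G δ r) {n : ℕ}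
    (hn : ∀ j, ¬ NextInvocation G δ r (σ.history n) j) {k : ℕ} (hk : n ≤ k) :
    σ.history k = σ.history n := by
  induction k, hk using Nat.le_induction with
  | base => rfl
  | succ k _ ih =>
    rcases σ.history_succ k with ⟨j, hj, -⟩ | ⟨-, h⟩
    · rw [ih] at hj
      exact absurd hj (hn j)
    · rw [h, ih]

/-- Two histories after which the dispatcher is never invoked again are the same. -/
theorem Schedule.history_eq_history (σ : Schedule G δ r) {n k : ℕ}
    (hn : ∀ j, ¬ NextInvocation G δ r (σ.history n) j)
    (hk : ∀ j, ¬ NextInvocation G δ r (σ.history k) j) : σ.history n = σ.history k := by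
  rcases le_total n k with h | h
  · exact (σ.history_eq_of_const hn h).symm
  · exact σ.history_eq_of_const hk h

/-! ### Idle capacity along a path -/

namespace IsTrace

variable {a b : ℝ}

/-- Between the end of all predecessors of `v` and the end of `v`, the idle speed is at most
`uniformity δ` times the speed reserved by the parts of `v`. -/
theorem integral_idle_le_wcet (hm : 0 < m) (hpos : ∀ p, 0 < δ p) (hsorted : Antitone δ)
    (hH : IsTrace G δ r H) (hterm : ∀ s, now r H ≤ s → ¬ MustInvoke G H s)
    (hmeet : ∀ j ∈ H, j.finish ≤ j.deadline) (hra : r ≤ a) (hab : a ≤ b)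
    (hpred : ∀ u, G.edge u v → VertexFinished H u a)
    (hv : ∃ j ∈ H, j.vertex = v ∧ b ≤ j.finish) :
    ∫ t in a..b, (totalSpeed δ - reservedSpeed δ H t) ≤ uniformity δ * G.wcet v := by
  classical
  have hlam := uniformity_nonneg hm hpos
  have hmem : ∀ {i}, i ∈ H.filter (·.vertex = v) → i ∈ H := fun h => (List.mem_filter.1 h).1
  have hpt : ∀ t ∈ Set.Ioo a b, totalSpeed δ - reservedSpeed δ H t ≤
      uniformity δ * reservedSpeed δ (H.filter (·.vertex = v)) t := by
    intro t ht
    obtain ⟨j, hj, hjv, hbj⟩ := hv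
    rcases hH.executing_or_busy (hra.trans ht.1.le) hterm
      (fun u hu => ⟨(hpred u hu).1, fun i hi hiu => ((hpred u hu).2 i hi hiu).trans ht.1.le⟩)
      ⟨j, hj, hjv, ht.2.trans_le hbj⟩ with ⟨i, hi, hiv, his, hif⟩ | hbusy
    · have hid := hif.trans_le (hmeet i hi)
      refine (hH.idle_le_of_occupied hpos hsorted hi his hid).trans
        (mul_le_mul_of_nonneg_left ?_ hlam)
      exact le_reservedSpeed_of_mem hpos (List.mem_filter.2 ⟨hi, by simpa using hiv⟩) his hid
    · have h := sum_occupied_le_reservedSpeed hpos H t Finset.univ fun q _ => hbusy q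
      have h' : totalSpeed δ - reservedSpeed δ H t ≤ 0 := sub_nonpos.2 h
      exact h'.trans (mul_nonneg hlam (reservedSpeed_nonneg hpos _ _))
  calc ∫ t in a..b, (totalSpeed δ - reservedSpeed δ H t)
      ≤ ∫ t in a..b, uniformity δ * reservedSpeed δ (H.filter (·.vertex = v)) t :=
        intervalIntegral.integral_mono_on_of_le_Ioo hab
          (intervalIntegrable_const.sub (intervalIntegrable_reservedSpeed _ _ _ _))
          ((intervalIntegrable_reservedSpeed _ _ _ _).const_mul _) hpt
    _ = uniformity δ * ∫ t in a..b, reservedSpeed δ (H.filter (·.vertex = v)) t :=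
        intervalIntegral.integral_const_mul _ _
    _ ≤ uniformity δ * G.wcet v := by
        refine mul_le_mul_of_nonneg_left ?_ hlam
        have h1 := integral_reservedSpeed_le hpos
          (fun i hi => hH.start_le_deadline hpos (hmem hi))
          (fun i hi => hH.wcet_eq hpos (hmem hi)) (H := H.filter (·.vertex = v)) hab
        linarith [sum_wcet_add_remaining G H v, hH.remaining_nonneg hpos v]

/-- The idle capacity up to a time at which `v` is unfinished. The path through `v` is extended
backwards in the induction, so the part `l` of it after `v` is carried along. -/
theorem integral_idle_add_le [Fintype V] (hm : 0 < m) (hpos : ∀ p, 0 < δ p)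
    (hsorted : Antitone δ) (hH : IsTrace G δ r H)
    (hterm : ∀ s, now r H ≤ s → ¬ MustInvoke G H s)
    (hmeet : ∀ j ∈ H, j.finish ≤ j.deadline) (hrb : r ≤ b)
    (hv : ∃ j ∈ H, j.vertex = v ∧ b ≤ j.finish) (l : List V) (hl : (v :: l).IsChain G.edge) :
    (∫ t in r..b, (totalSpeed δ - reservedSpeed δ H t)) + uniformity δ * (l.map G.wcet).sum ≤
      uniformity δ * G.criticalPath := by
  have hlam := uniformity_nonneg hm hpos
  have hS := not_inS_of_terminal hm hterm
  induction v using G.wellFounded_edge.induction generalizing b l with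
  | _ v ih =>
    by_cases hu : ∃ u, G.edge u v
    · -- `u` is a predecessor of `v` finished last, namely with its part `k`.
      obtain ⟨k, hk, huv, hlast⟩ : ∃ k ∈ H, G.edge k.vertex v ∧
          ∀ i ∈ H, G.edge i.vertex v → i.finish ≤ k.finish := by
        obtain ⟨u, hu⟩ := hu
        obtain ⟨i, hi, rfl, -⟩ := exists_whole_of_not_inS (hS u)
        obtain ⟨k, hk, hmax⟩ := Set.exists_max_image {i | i ∈ H ∧ G.edge i.vertex v} Job.finish
          ((List.finite_toSet H).subset fun i hi => hi.1) ⟨i, hi, hu⟩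
        exact ⟨k, hk.1, hk.2, fun i hi hiv => hmax i ⟨hi, hiv⟩⟩
      have hchain : (k.vertex :: v :: l).IsChain G.edge := List.isChain_cons_cons.2 ⟨huv, hl⟩
      have hrk : r ≤ k.finish := (hH.release_le_start hk).trans (hH.start_le_finish hk)
      rcases le_total b k.finish with hb | hb
      · have h := ih k.vertex huv hrb ⟨k, hk, rfl, hb⟩ (v :: l) hchain
        rw [List.map_cons, List.sum_cons, mul_add] at h
        linarith [mul_nonneg hlam (G.wcet_nonneg v)]
      · have h1 := ih k.vertex huv hrk ⟨k, hk, rfl, le_rfl⟩ (v :: l) hchain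
        have h2 := hH.integral_idle_le_wcet hm hpos hsorted hterm hmeet hrk hb
          (fun u hu => ⟨hS u, fun i hi hiu => hlast i hi (hiu ▸ hu)⟩) hv
        have hint : ∀ x y, IntervalIntegrable
            (fun t => totalSpeed δ - reservedSpeed δ H t) volume x y := fun x y =>
          intervalIntegrable_const.sub (intervalIntegrable_reservedSpeed _ _ _ _)
        rw [List.map_cons, List.sum_cons, mul_add] at h1
        rw [← intervalIntegral.integral_add_adjacent_intervals (hint r k.finish)
          (hint k.finish b)]
        linarith
    · have h1 := hH.integral_idle_le_wcet hm hpos hsorted hterm hmeet le_rfl hrb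
        (fun u h => absurd ⟨u, h⟩ hu) hv
      have h2 := mul_le_mul_of_nonneg_left (G.sum_le_criticalPath hl) hlam
      rw [List.map_cons, List.sum_cons, mul_add] at h2
      linarith

/-- The bound on the response time, for the time at which any part of a vertex is finished. -/
theorem totalSpeed_mul_le [Fintype V] (hm : 0 < m) (hpos : ∀ p, 0 < δ p)
    (hsorted : Antitone δ) (hH : IsTrace G δ r H)
    (hterm : ∀ s, now r H ≤ s → ¬ MustInvoke G H s)
    (hmeet : ∀ j ∈ H, j.finish ≤ j.deadline) (hj : j ∈ H) :
    totalSpeed δ * (j.finish - r) ≤ G.volume + uniformity δ * G.criticalPath := by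
  have hrj : r ≤ j.finish := (hH.release_le_start hj).trans (hH.start_le_finish hj)
  have h1 := hH.integral_idle_add_le hm hpos hsorted hterm hmeet hrj ⟨j, hj, rfl, le_rfl⟩ []
    (List.isChain_singleton _)
  rw [intervalIntegral.integral_sub intervalIntegrable_const
    (intervalIntegrable_reservedSpeed _ _ _ _), intervalIntegral.integral_const] at h1
  have h2 := integral_reservedSpeed_le hpos (fun i hi => hH.start_le_deadline hpos hi)
    (fun i hi => hH.wcet_eq hpos hi) hrj
  have h3 := sum_wcet_add_sum_remaining G H
  have h4 : 0 ≤ ∑ v, remaining G H v := Finset.sum_nonneg fun v _ => hH.remaining_nonneg hpos v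
  simp only [smul_eq_mul, List.map_nil, List.sum_nil, mul_zero, add_zero] at h1
  linarith [mul_comm (totalSpeed δ) (j.finish - r)]

end IsTrace

end Trace

end SemiFederated

open SemiFederated in
theorem theorem2 {V : Type*} [Fintype V] (G : SemiFederated.DAGTask V)
    {m : ℕ} (hm : 0 < m) (δ : Fin m → ℝ) (hpos : ∀ p, 0 < δ p) (hsorted : Antitone δ)
    (r : ℝ) (σ : SemiFederated.Schedule G δ r) (hmeet : σ.MeetsDeadlines) :
    ∃ R : ℝ, σ.IsResponseTime R ∧
      R ≤ (G.volume + SemiFederated.uniformity δ * G.criticalPath) /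
        SemiFederated.totalSpeed δ := by
  obtain ⟨n, hterm⟩ := σ.exists_terminal
  have hH := σ.isTrace n
  have hS := not_inS_of_terminal hm hterm
  have hnext : ∀ {k}, (∀ v, ¬ InS (σ.history k) v) →
      ∀ j, ¬ NextInvocation G δ r (σ.history k) j := fun h j hj => h _ hj.2.2.eligible.1
  rcases isEmpty_or_nonempty V with hV | ⟨⟨v⟩⟩
  · refine ⟨0, ⟨⟨le_rfl, n, fun v => hV.elim v⟩, fun x hx => hx.1⟩, ?_⟩
    exact div_nonneg (add_nonneg G.volume_nonneg
      (mul_nonneg (uniformity_nonneg hm hpos) G.criticalPath_nonneg)) (totalSpeed_pos hm hpos).le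
  · obtain ⟨i, hi, -⟩ := exists_whole_of_not_inS (hS v)
    obtain ⟨j, hj, hmax⟩ := Set.exists_max_image {i | i ∈ σ.history n} Job.finish
      (List.finite_toSet _) ⟨i, hi⟩
    refine ⟨j.finish - r, ⟨⟨?_, n, fun u => ⟨hS u, fun k hk _ => ?_⟩⟩, ?_⟩, ?_⟩
    · exact sub_nonneg.2 ((hH.release_le_start hj).trans (hH.start_le_finish hj))
    · rw [add_sub_cancel]
      exact hmax k hk
    · rintro x ⟨-, k, hk⟩
      have heq := σ.history_eq_history (hnext hS) (hnext fun u => (hk u).1)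
      have hle := (hk j.vertex).2 j (heq ▸ hj) rfl
      linarith
    · rw [le_div_iff₀ (totalSpeed_pos hm hpos), mul_comm]
      exact hH.totalSpeed_mul_le hm hpos hsorted hterm (hmeet n) hj
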